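/- **Theorem (FairDAG-AB Liveness).** Consider $n$ replicas of which at most $f$ are Byzantine, $n>3f$; the others are *correct*. Replicas run FairDAG-AB, as follows, on top of a DAG-based consensus layer. *Local orderings.* When a correct replica receives a valid transaction with digest $d$ from a client, it appends $(d,oi)$ to its pending list, where $oi\in\mathbb N$ is the reading of its local timer; the timer is non-decreasing and unbounded. In each round $r=0,1,2,\dots$ it reliably broadcasts a vertex that contains, and clears, the pending list. A vertex of round $r>0$ has at least $n-f$ strong edges to vertices of round $r-1$, one of them to its author's own previous vertex, and at most $f$ weak edges to vertices of earlier rounds. Each correct replica keeps a local view of the DAG, to which it adds a vertex only after all vertices that it refers to; correct replicas never add two different vertices of the same author and round, and a vertex added under the name of a correct replica was broadcast by it. *DAG layer.* Replicas commit leader vertices $L_r$ ($r$ is the round). The subdag $A_r$ consists of the vertices reachable from $L_r$ ($L_r$ included) that are reachable from no leader committed before. The layer guarantees: *Agreement* (if a correct replica commits $A_r$, every correct replica eventually does); *Total Ascending Order* (if a correct replica commits $A_r$ before $A_{r'}$, then $r<r'$, and no correct replica commits $A_{r'}$ before $A_r$); *Validity* (if a correct replica broadcasts a vertex $v$, every correct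 replica eventually commits some $L_r$ with $v\in A_r$). Every committed subdag is eventually processed, in order of commitment, by the fairness layer of the replica. *Fairness layer.* Each replica stores, for every digest $d$ and every replica $i$, the indicators $seen_d[i]$ and $committed_d[i]$ (initially $\infty$), the latest indicator of $d$ in the vertices of $i$ that were added to its view, respectively processed by its fairness layer, and $highest[i]$ (initially $0$), the highest indicator in the latest vertex of $i$ in its view that contains an indicator. All $d.AOI$ and $d.LPAOI$ are initially $\infty$. When it processes a subdag, it first updates the $committed$ values. Then, for each $d$ with $d.AOI=\infty$: if at least $n-f$ of the $committed_d[i]$ are finite, it sets $d.AOI$, once and for all, to the $(f+1)$-th smallest entry of $committed_d$; otherwise it sets $d.LPAOI$ to the $(f+1)$-th smallest of the numbers $\min(seen_d[i],highest[i])$, $1\le i\le n$. Finally, with $LPAOI_{\min}$ the infimum of $d.LPAOI$ over all $d$ that still have $d.AOI=\infty$, it appends to its final ordering, sorted by AOI, all digests not yet ordered whose AOI is less than $LPAOI_{\min}$. *Clients.* Assume that a transaction received by one correct replica is eventually received by every correct replica, and that every correct replica keeps receiving valid transactions forever. Then for every valid transaction $T$, with digest $d$, that is received by some correct replica, and for every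 correct replica $R$, there are $a\in\mathbb N$ and a time $t_0$ such that at all times $t\ge t_0$, at $R$: $d.AOI=a$; every digest $d'$ with $d'.AOI=\infty$ has $d'.LPAOI>a$; and $d$ is in the final ordering of $R$. -/

import Mathlib

namespace FairDAG

/-- A DAG vertex.  `author` is the replica that proposes it, `round` its round, `payload` the slice
of the author's local ordering (the lists `dgs` and `ois`, zipped), and `strong`, `weak` are its
edges.  An edge names the vertex it points to by author and round. -/
structure Vertex (n : ℕ) (D : Type*) where
  author : Fin n
  round : ℕ
  payload : List (D × ℕ)
  strong : Finset (Fin n × ℕ)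
  weak : Finset (Fin n × ℕ)

namespace Vertex

variable {n : ℕ} {D : Type*}

/-- The name of a vertex in edges. -/
def id (v : Vertex n D) : Fin n × ℕ := (v.author, v.round)

/-- All edges of a vertex. -/
def refs (v : Vertex n D) : Finset (Fin n × ℕ) := v.strong ∪ v.weak

/-- Validity of a vertex: a vertex of a positive round has at least `n - f` strong edges, all to the
previous round and one of them to the author's own previous vertex, and at most `f` weak edges, to
earlier rounds.  A vertex of round `0` has no edges. -/
def WellFormed (f : ℕ) (v : Vertex n D) : Prop :=
  (v.round = 0 → v.strong = ∅ ∧ v.weak = ∅) ∧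
  (0 < v.round →
    (∀ e ∈ v.strong, e.2 + 1 = v.round) ∧
    n - f ≤ v.strong.card ∧
    (v.author, v.round - 1) ∈ v.strong ∧
    (∀ e ∈ v.weak, e.2 + 1 < v.round) ∧
    v.weak.card ≤ f)

/-- All edges of `v` lead to vertices of the local DAG view `view`. -/
def RefsIn (v : Vertex n D) (view : Set (Vertex n D)) : Prop :=
  ∀ e ∈ v.refs, ∃ w ∈ view, w.id = e

end Vertex

/-- The causal history of `L` in a local DAG view: `L` and every vertex reachable from it. -/
def causalHistory {n : ℕ} {D : Type*} (view : Set (Vertex n D)) (L : Vertex n D) :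
    Set (Vertex n D) :=
  {v | Relation.ReflTransGen (fun u w => w ∈ view ∧ w.id ∈ u.refs) L v}

/-- A deterministic rule that enumerates every finite set of vertices, without repetition. -/
structure Enumeration (n : ℕ) (D : Type*) where
  toList : Set (Vertex n D) → List (Vertex n D)
  nodup : ∀ S : Set (Vertex n D), S.Finite → (toList S).Nodup
  mem_toList : ∀ S : Set (Vertex n D), S.Finite → ∀ v, v ∈ toList S ↔ v ∈ S

/-- The `(k + 1)`-th smallest entry of the vector `x`. -/
noncomputable def nthSmallest {n : ℕ} (k : ℕ) (x : Fin n → ℕ∞) : ℕ∞ :=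
  if h : k < n then x (Tuple.sort x ⟨k, h⟩) else ⊤

/-- The state of a replica.  `⊤ : ℕ∞` is the value `∞` of the algorithm. -/
structure ReplicaState (n : ℕ) (D : Type*) where
  /-- `current_round`, the round of the next vertex that the replica proposes. -/
  round : ℕ
  /-- The pending local ordering: the lists `dgs` and `ois`, zipped. -/
  pending : List (D × ℕ)
  /-- The local DAG view: the vertices delivered so far. -/
  view : Set (Vertex n D)
  /-- The union of the causal histories of the leaders committed so far. -/
  committed : Set (Vertex n D)
  /-- The committed subdags sent to the fairness layer but not yet processed by it. -/
  queue : List (List (Vertex n D))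
  /-- `highest_oi_list`. -/
  highest : Fin n → ℕ
  /-- `OIM(d).seen_ois`. -/
  seenOis : D → Fin n → ℕ∞
  /-- `OIM(d).committed_ois`. -/
  committedOis : D → Fin n → ℕ∞
  /-- The digests in the subdags processed so far; no other digest has a committed indicator. -/
  digests : Finset D
  /-- `OIM(d).LPAOI`. -/
  lpaoi : D → ℕ∞
  /-- `OIM(d).AOI`. -/
  aoi : D → ℕ∞
  /-- `txns_w_assigned_oi`: digests that have an AOI and are not ordered yet. -/
  txnsWithAoi : Finset D
  /-- The final ordering: the digests executed so far, in the order of execution. -/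
  final : List D

/-- The events at a replica. -/
inductive Event (n : ℕ) (Tx D : Type*) where
  /-- Nothing happens. -/
  | idle
  /-- A transaction arrives from a client. -/
  | receive (T : Tx)
  /-- The replica proposes and reliably broadcasts its next vertex, with the given edges. -/
  | propose (strong weak : Finset (Fin n × ℕ))
  /-- A vertex is delivered and added to the local DAG view. -/
  | deliver (v : Vertex n D)
  /-- A leader vertex is committed and its subdag is sent to the fairness layer. -/
  | commit (L : Vertex n D)
  /-- The fairness layer receives and processes the next committed subdag. -/
  | process

namespace ReplicaState

variable {n : ℕ} {D : Type*}

/-- The initial state. -/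
def init : ReplicaState n D where
  round := 0
  pending := []
  view := ∅
  committed := ∅
  queue := []
  highest := fun _ => 0
  seenOis := fun _ _ => ⊤
  committedOis := fun _ _ => ⊤
  digests := ∅
  lpaoi := fun _ => ⊤
  aoi := fun _ => ⊤
  txnsWithAoi := ∅
  final := []

/-- The vertex that replica `R` broadcasts when it proposes in this state. -/
def nextVertex (s : ReplicaState n D) (R : Fin n) (strong weak : Finset (Fin n × ℕ)) :
    Vertex n D :=
  ⟨R, s.round, s.pending, strong, weak⟩

/-- The subdag of the leader `L`: the vertices in the causal history of `L` that are in the causal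
history of no leader committed before. -/
def subdag (s : ReplicaState n D) (L : Vertex n D) : Set (Vertex n D) :=
  causalHistory s.view L \ s.committed

/-- `for (d, oi) in v: ois(d)[v.author] := oi`. -/
def record [DecidableEq D] (ois : D → Fin n → ℕ∞) (v : Vertex n D) : D → Fin n → ℕ∞ :=
  v.payload.foldl
    (fun tbl p => fun d i => if d = p.1 ∧ i = v.author then (p.2 : ℕ∞) else tbl d i) ois

/-- On delivery of `v`.  A vertex with an empty slice of the local ordering has no highest
indicator and leaves `highest` as it is. -/
def deliver [DecidableEq D] (s : ReplicaState n D) (v : Vertex n D) : ReplicaState n D :=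
  { s with
    view := insert v s.view
    highest := Function.update s.highest v.author
      ((v.payload.map Prod.snd).max?.getD (s.highest v.author))
    seenOis := record s.seenOis v }

/-- On commit of the leader `L`. -/
def commit (enum : Enumeration n D) (s : ReplicaState n D) (L : Vertex n D) : ReplicaState n D :=
  { s with
    committed := s.committed ∪ causalHistory s.view L
    queue := s.queue ++ [enum.toList (s.subdag L)] }

open Classical in
/-- The fairness layer, on receipt of the subdag `A`. -/
noncomputable def processSubdag [LinearOrder D] (f : ℕ) (s : ReplicaState n D)
    (A : List (Vertex n D)) : ReplicaState n D :=
  let committedOis := A.foldl record s.committedOis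
  let digests := s.digests ∪ (A.flatMap fun v => v.payload.map Prod.fst).toFinset
  -- the digests that get their AOI now
  let newly : Finset D := digests.filter fun d =>
    s.aoi d = ⊤ ∧ n - f ≤ (Finset.univ.filter fun i => committedOis d i ≠ ⊤).card
  let aoi : D → ℕ∞ := fun d => if d ∈ newly then nthSmallest f (committedOis d) else s.aoi d
  let lpaoi : D → ℕ∞ := fun d =>
    if aoi d = ⊤ then nthSmallest f (fun i => min (s.seenOis d i) (s.highest i : ℕ∞))
    else s.lpaoi d
  let lpaoiMin : ℕ∞ := ⨅ (d : D) (_ : aoi d = ⊤), lpaoi d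
  let txns : Finset D := s.txnsWithAoi ∪ newly
  -- the digests that are ordered now
  let ready : Finset D := txns.filter fun d => aoi d < lpaoiMin
  { s with
    committedOis := committedOis
    digests := digests
    aoi := aoi
    lpaoi := lpaoi
    txnsWithAoi := txns \ ready
    -- sorted by AOI, ties broken by the digests
    final := s.final ++ (ready.sort (· ≤ ·)).mergeSort (fun d e => decide (aoi d ≤ aoi e)) }

/-- The fairness layer takes the first subdag of the queue, if there is one. -/
noncomputable def process [LinearOrder D] (f : ℕ) (s : ReplicaState n D) : ReplicaState n D :=
  match s.queue with
  | [] => s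
  | A :: rest => { processSubdag f s A with queue := rest }

end ReplicaState

/-- The data of a run: who is correct, and what happens at each replica at each time.  The entries
for replicas that are not correct have no meaning: those replicas are arbitrary, and act on the
correct ones through the vertices that these deliver. -/
structure Execution (n : ℕ) (Tx D : Type*) where
  /-- The replicas that are never corrupted. -/
  correct : Finset (Fin n)
  /-- The digest of a transaction. -/
  digest : Tx → D
  /-- Which transactions are valid. -/
  valid : Tx → Prop
  /-- The deterministic order in which the vertices of a subdag are committed. -/
  enum : Enumeration n D
  /-- The author of the leader vertex of a round, for the rounds that have a leader. -/
  leader : ℕ → Option (Fin n)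
  /-- The reading of the local timer of a replica at each time. -/
  timer : Fin n → ℕ → ℕ
  /-- The event at a replica at each time. -/
  event : Fin n → ℕ → Event n Tx D

namespace Execution

variable {n : ℕ} {Tx D : Type*} [LinearOrder D]

open Classical in
/-- The effect on the state of replica `R` of the event that happens to it at time `t`. -/
noncomputable def step (E : Execution n Tx D) (f : ℕ) (R : Fin n) (t : ℕ)
    (s : ReplicaState n D) : ReplicaState n D :=
  match E.event R t with
  | .idle => s
  | .receive T =>
      if E.valid T then { s with pending := s.pending ++ [(E.digest T, E.timer R t)] } else s
  | .propose _ _ => { s with round := s.round + 1, pending := [] }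
  | .deliver v => s.deliver v
  | .commit L => s.commit E.enum L
  | .process => s.process f

/-- The state of replica `R` at time `t`, before the event at time `t`. -/
noncomputable def state (E : Execution n Tx D) (f : ℕ) (R : Fin n) : ℕ → ReplicaState n D
  | 0 => ReplicaState.init
  | t + 1 => E.step f R t (E.state f R t)

/-- Replica `R` receives the transaction `T` at time `t`. -/
def ReceivesAt (E : Execution n Tx D) (R : Fin n) (T : Tx) (t : ℕ) : Prop :=
  E.event R t = .receive T

/-- Replica `R` broadcasts the vertex `v` at time `t`. -/
def BroadcastsAt (E : Execution n Tx D) (f : ℕ) (R : Fin n) (v : Vertex n D) (t : ℕ) : Prop :=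
  ∃ strong weak, E.event R t = .propose strong weak ∧
    v = (E.state f R t).nextVertex R strong weak

/-- Replica `R` commits the leader vertex `L` with subdag `A` at time `t`. -/
def CommitsAt (E : Execution n Tx D) (f : ℕ) (R : Fin n) (L : Vertex n D) (A : Set (Vertex n D))
    (t : ℕ) : Prop :=
  E.event R t = .commit L ∧ A = (E.state f R t).subdag L

/-- The correct replicas follow the algorithm. -/
structure FollowsProtocol (E : Execution n Tx D) (f : ℕ) : Prop where
  /-- Local timers do not run backwards. -/
  timer_mono : ∀ R ∈ E.correct, Monotone (E.timer R)
  /-- Local timers do not stop. -/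
  timer_unbounded : ∀ R ∈ E.correct, ∀ b, ∃ t, b < E.timer R t
  /-- A correct replica proposes valid vertices, with edges to vertices of its view. -/
  propose_ok : ∀ R ∈ E.correct, ∀ t v, E.BroadcastsAt f R v t →
    v.WellFormed f ∧ v.RefsIn (E.state f R t).view
  /-- A correct replica adds a vertex to its view once, if it is valid, and after the vertices that
  it refers to. -/
  deliver_ok : ∀ R ∈ E.correct, ∀ t v, E.event R t = .deliver v →
    v.WellFormed f ∧ v.RefsIn (E.state f R t).view ∧ ∀ w ∈ (E.state f R t).view, w.id ≠ v.id
  /-- A correct replica commits leader vertices of its view. -/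
  commit_ok : ∀ R ∈ E.correct, ∀ t L, E.event R t = .commit L →
    L ∈ (E.state f R t).view ∧ E.leader L.round = some L.author
  /-- The fairness layer of a correct replica processes what it is sent. -/
  process_fair : ∀ R ∈ E.correct, ∀ t, (E.state f R t).queue ≠ [] →
    ∃ t' ≥ t, E.event R t' = .process

/-- The guarantees of the underlying DAG-based consensus protocol. -/
structure DAGLayer (E : Execution n Tx D) (f : ℕ) : Prop where
  /-- Authentication: a vertex delivered under the name of a correct replica was broadcast by it. -/
  authentic : ∀ R ∈ E.correct, ∀ t v, E.event R t = .deliver v → v.author ∈ E.correct →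
    ∃ t' < t, E.BroadcastsAt f v.author v t'
  /-- Reliable broadcast: correct replicas deliver no two different vertices of the same author and
  round. -/
  consistent : ∀ R ∈ E.correct, ∀ R' ∈ E.correct, ∀ t t' v v',
    E.event R t = .deliver v → E.event R' t' = .deliver v' → v.id = v'.id → v = v'
  /-- In each round, every correct replica proposes a vertex. -/
  proposes : ∀ R ∈ E.correct, ∀ r, ∃ t v, E.BroadcastsAt f R v t ∧ v.round = r
  /-- Agreement. -/
  agreement : ∀ R ∈ E.correct, ∀ t L A, E.CommitsAt f R L A t →
    ∀ R' ∈ E.correct, ∃ t', E.CommitsAt f R' L A t'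
  /-- Total ascending order. -/
  total_order : ∀ R ∈ E.correct, ∀ t t' L L' A A', t < t' →
    E.CommitsAt f R L A t → E.CommitsAt f R L' A' t' →
    L.round < L'.round ∧
    ∀ R' ∈ E.correct, ¬ ∃ u u', u < u' ∧ E.CommitsAt f R' L' A' u ∧ E.CommitsAt f R' L A u'
  /-- Validity. -/
  validity : ∀ R ∈ E.correct, ∀ t v, E.BroadcastsAt f R v t →
    ∀ R' ∈ E.correct, ∃ t' L A, E.CommitsAt f R' L A t' ∧ v ∈ A

/-- A transaction received by one correct replica is eventually received by all of them. -/
def CorrectReplicasShareReceipts (E : Execution n Tx D) : Prop :=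
  ∀ T, ∀ R ∈ E.correct, ∀ t, E.ReceivesAt R T t → ∀ R' ∈ E.correct, ∃ t', E.ReceivesAt R' T t'

/-- Every correct replica keeps receiving valid transactions from the clients. -/
def OngoingTraffic (E : Execution n Tx D) : Prop :=
  ∀ R ∈ E.correct, ∀ t, ∃ t' ≥ t, ∃ T, E.valid T ∧ E.ReceivesAt R T t'

end Execution

end FairDAG

/-! Let `d` be the digest of the transaction. Every correct replica receives it, puts it in its
pending list and broadcasts it, and by validity every correct replica `R` processes all these
vertices. Hence at least `n - f` committed indicators of `d` become finite, and the next processing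
assigns an AOI if there is none yet. It is finite because `f + 1 ≤ n - f` (`exists_aoi`). Call it
`a`.

It remains to push the LPAOI of every unassigned digest above `a`. At most `f` replicas are
Byzantine, so it suffices that `min(seen, highest)` exceeds `a` at every correct `i`. For `highest`:
the timer of `i` passes `a`, traffic continues, and the vertices of `i` are delivered in order of
rounds (`eventually_lt_highest`). For `seen`: an indicator of `i` that is at most `a` comes from a
receipt before the timer passed `a`. There are finitely many such receipts, and each of their
digests eventually has an AOI. This gives one time that serves all unassigned digests at once
(`eventually_lt_seenOis`).

The stored LPAOI changes only when a subdag is processed, so one further processing, which always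
comes (`exists_processesAt_ge`), makes the bound effective and orders `d`. -/

namespace FairDAG

/-! ### Order statistics and indicator tables -/

/-- Otherwise the first `k + 1` sorted positions would all hold entries at most `a`. Used with `k =
f`, where only Byzantine replicas can have small entries. -/
theorem lt_nthSmallest {n k : ℕ} (hk : k < n) (x : Fin n → ℕ∞) (a : ℕ∞)
    (h : (Finset.univ.filter fun i => x i ≤ a).card ≤ k) : a < nthSmallest k x := by
  rw [nthSmallest, dif_pos hk]
  by_contra! hle
  have hsub : (Finset.Iic (⟨k, hk⟩ : Fin n)).map (Tuple.sort x).toEmbedding ⊆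
      Finset.univ.filter fun i => x i ≤ a := by
    intro i hi
    obtain ⟨j, hj, rfl⟩ := Finset.mem_map.1 hi
    exact Finset.mem_filter.2 ⟨Finset.mem_univ _,
      (Tuple.monotone_sort x (Finset.mem_Iic.1 hj)).trans hle⟩
  have := Finset.card_le_card hsub
  rw [Finset.card_map, Fin.card_Iic] at this
  simp only at this
  omega

/-- An infinite entry at sorted position `k` confines the finite entries to the `k` positions before
it. -/
theorem nthSmallest_ne_top {n k : ℕ} (hk : k < n) (x : Fin n → ℕ∞)
    (h : k < (Finset.univ.filter fun i => x i ≠ ⊤).card) : nthSmallest k x ≠ ⊤ := by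
  rw [nthSmallest, dif_pos hk]
  intro htop
  have hsub : (Finset.univ.filter fun i => x i ≠ ⊤) ⊆
      (Finset.Iio (⟨k, hk⟩ : Fin n)).map (Tuple.sort x).toEmbedding := by
    intro i hi
    refine Finset.mem_map.2 ⟨(Tuple.sort x).symm i, Finset.mem_Iio.2 ?_, by simp⟩
    by_contra! hle
    have hmono := Tuple.monotone_sort x hle
    simp only [Function.comp_apply, Equiv.apply_symm_apply, htop, top_le_iff] at hmono
    exact (Finset.mem_filter.1 hi).2 hmono
  have := Finset.card_le_card hsub
  rw [Finset.card_map, Fin.card_Iio] at this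
  simp only at this
  omega

namespace ReplicaState

variable {n : ℕ} {D : Type*}

/-- A later entry for the same digest overwrites an earlier one, so a changed value is only known to
come from some entry of the payload. The negative clause rules out that a matching entry is ignored.
-/
theorem record_eq_or [DecidableEq D] (tbl : D → Fin n → ℕ∞) (v : Vertex n D) (d : D) (i : Fin n) :
    (record tbl v d i = tbl d i ∧ (i = v.author → ∀ oi, (d, oi) ∉ v.payload)) ∨
      (i = v.author ∧ ∃ oi : ℕ, (d, oi) ∈ v.payload ∧ record tbl v d i = oi) := by
  unfold record
  generalize v.payload = l
  induction l generalizing tbl with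
  | nil => exact .inl ⟨rfl, by simp⟩
  | cons p l ih =>
    rw [List.foldl_cons]
    rcases ih (fun d i => if d = p.1 ∧ i = v.author then (p.2 : ℕ∞) else tbl d i) with
      ⟨h, h'⟩ | ⟨h, oi, hoi, h'⟩
    · by_cases hp : d = p.1 ∧ i = v.author
      · refine .inr ⟨hp.2, p.2, ?_, by rw [h, if_pos hp]⟩
        rw [hp.1]
        exact List.mem_cons_self
      · refine .inl ⟨by rw [h, if_neg hp], fun hi oi hmem => ?_⟩
        rcases List.mem_cons.1 hmem with rfl | hmem
        · exact hp ⟨rfl, hi⟩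
        · exact h' hi oi hmem
    · exact .inr ⟨h, oi, List.mem_cons_of_mem _ hoi, h'⟩

theorem record_ne_top [DecidableEq D] {tbl : D → Fin n → ℕ∞} (v : Vertex n D) {d : D} {i : Fin n}
    (h : tbl d i ≠ ⊤) : record tbl v d i ≠ ⊤ := by
  rcases record_eq_or tbl v d i with ⟨h', -⟩ | ⟨-, oi, -, h'⟩ <;> rw [h']
  · exact h
  · exact ENat.natCast_ne_top oi

theorem record_ne_top_of_mem [DecidableEq D] (tbl : D → Fin n → ℕ∞) {v : Vertex n D} {d : D}
    {oi : ℕ} (h : (d, oi) ∈ v.payload) : record tbl v d v.author ≠ ⊤ := by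
  rcases record_eq_or tbl v d v.author with ⟨-, h'⟩ | ⟨-, oi, -, h'⟩
  · exact absurd h (h' rfl oi)
  · rw [h']
    exact ENat.natCast_ne_top oi

theorem foldl_record_ne_top [DecidableEq D] (A : List (Vertex n D)) {tbl : D → Fin n → ℕ∞} {d : D}
    {i : Fin n} (h : tbl d i ≠ ⊤) : A.foldl record tbl d i ≠ ⊤ := by
  induction A generalizing tbl with
  | nil => exact h
  | cons v A ih => exact ih (record_ne_top v h)

theorem foldl_record_ne_top_of_mem [DecidableEq D] {A : List (Vertex n D)}
    (tbl : D → Fin n → ℕ∞) {v : Vertex n D} (hv : v ∈ A) {d : D} {oi : ℕ}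
    (h : (d, oi) ∈ v.payload) : A.foldl record tbl d v.author ≠ ⊤ := by
  induction A generalizing tbl with
  | nil => simp at hv
  | cons w A ih =>
    rcases List.mem_cons.1 hv with rfl | hv
    · exact foldl_record_ne_top A (record_ne_top_of_mem tbl h)
    · exact ih _ hv

/-! ### Processing a subdag -/

variable [LinearOrder D] {f : ℕ}

theorem processSubdag_aoi_of_ne_top {s : ReplicaState n D} (A : List (Vertex n D)) {d : D}
    (h : s.aoi d ≠ ⊤) : (processSubdag f s A).aoi d = s.aoi d := by
  simp [processSubdag, h]

theorem processSubdag_aoi_ne_top (hf : f < n - f) {s : ReplicaState n D} (A : List (Vertex n D))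
    {d : D} (hd : d ∈ s.digests)
    (h : n - f ≤ (Finset.univ.filter fun i => s.committedOis d i ≠ ⊤).card) :
    (processSubdag f s A).aoi d ≠ ⊤ := by
  by_cases hd' : s.aoi d = ⊤
  -- Recording `A` never makes a finite indicator infinite, so the quorum survives it.
  · have hcard : n - f ≤
        (Finset.univ.filter fun i => A.foldl record s.committedOis d i ≠ ⊤).card :=
      h.trans (Finset.card_le_card fun i hi => by
        rw [Finset.mem_filter] at hi ⊢
        exact ⟨hi.1, foldl_record_ne_top A hi.2⟩)
    have := nthSmallest_ne_top (by omega) (A.foldl record s.committedOis d) (hf.trans_le hcard)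
    simp only [processSubdag]
    rw [if_pos]
    · exact this
    · rw [Finset.mem_filter]
      exact ⟨Finset.mem_union_left _ hd, hd', hcard⟩
  · rwa [processSubdag_aoi_of_ne_top A hd']

theorem processSubdag_lpaoi {s : ReplicaState n D} (A : List (Vertex n D)) {d : D}
    (h : (processSubdag f s A).aoi d = ⊤) :
    (processSubdag f s A).lpaoi d =
      nthSmallest f fun i => min (s.seenOis d i) (s.highest i : ℕ∞) :=
  if_pos h

/-- Every digest with an AOI is ordered or waits to be ordered. -/
def AssignedTracked (s : ReplicaState n D) : Prop :=
  ∀ d, s.aoi d ≠ ⊤ → d ∈ s.txnsWithAoi ∨ d ∈ s.final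

/-- A digest joins `txnsWithAoi` in the same call that assigns its AOI, and leaves it only for
`final`. -/
theorem AssignedTracked.processSubdag {s : ReplicaState n D} (hs : s.AssignedTracked)
    (A : List (Vertex n D)) : (processSubdag f s A).AssignedTracked := by
  intro d hd
  simp only [ReplicaState.processSubdag] at hd ⊢
  simp only [Finset.mem_sdiff, List.mem_append, List.mem_mergeSort, Finset.mem_sort,
    Finset.mem_union]
  by_cases hfin : d ∈ s.final
  · exact .inr (.inl hfin)
  · split_ifs at hd with hnew
    · simp only [Finset.mem_filter, Finset.mem_union] at hnew ⊢
      tauto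
    · have := hs d hd
      simp only [Finset.mem_filter, Finset.mem_union] at hnew ⊢
      tauto

theorem mem_final_processSubdag {s : ReplicaState n D} (hs : s.AssignedTracked)
    (A : List (Vertex n D)) {d : D} {a : ℕ} (hd : s.aoi d = a)
    (h : ∀ d', (processSubdag f s A).aoi d' = ⊤ → (a : ℕ∞) < (processSubdag f s A).lpaoi d') :
    d ∈ (processSubdag f s A).final := by
  have hd' : s.aoi d ≠ ⊤ := hd ▸ ENat.natCast_ne_top a
  have haoi := (processSubdag_aoi_of_ne_top (f := f) A hd').trans hd
  have hmin : (a : ℕ∞) < ⨅ (d : D) (_ : (processSubdag f s A).aoi d = ⊤),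
      (processSubdag f s A).lpaoi d := by
    -- The infimum may range over infinitely many digests, where strict bounds need not pass to the
    -- limit; in `ℕ∞` they become the bound `a + 1`, which does.
    refine (ENat.add_one_le_iff (ENat.natCast_ne_top a)).1 (le_iInf₂ fun d' h' => ?_)
    exact (ENat.add_one_le_iff (ENat.natCast_ne_top a)).2 (h d' h')
  rcases hs d hd' with htx | hfin
  · refine List.mem_append_right _ (List.mem_mergeSort.2 ((Finset.mem_sort _).2 ?_))
    refine Finset.mem_filter.2 ⟨Finset.mem_union_left _ htx, ?_⟩
    exact haoi.trans_lt hmin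
  · exact List.mem_append_left _ hfin

theorem process_cases (f : ℕ) (s : ReplicaState n D) :
    (s.queue = [] ∧ s.process f = s) ∨
      ∃ A rest, s.queue = A :: rest ∧ s.process f = { processSubdag f s A with queue := rest } := by
  unfold process
  split
  · exact .inl ⟨by assumption, rfl⟩
  · exact .inr ⟨_, _, by assumption, rfl⟩

end ReplicaState

theorem causalHistory_subset {n : ℕ} {D : Type*} {view : Set (Vertex n D)} {L : Vertex n D}
    (hL : L ∈ view) : causalHistory view L ⊆ view := by
  intro v hv
  induction hv with
  | refl => exact hL
  | tail _ h _ => exact h.1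

namespace Execution

open ReplicaState

variable {n : ℕ} {Tx D : Type*} [LinearOrder D] {E : Execution n Tx D} {f : ℕ} {R : Fin n}

/-! ### The evolution of the state -/

theorem state_succ (t : ℕ) : E.state f R (t + 1) = E.step f R t (E.state f R t) := rfl

theorem view_succ (t : ℕ) : (E.state f R (t + 1)).view = (E.state f R t).view ∨
    ∃ v, E.event R t = .deliver v ∧
      (E.state f R (t + 1)).view = insert v (E.state f R t).view := by
  rw [state_succ, step]
  cases h : E.event R t with
  | receive T => dsimp only; split_ifs <;> exact .inl rfl
  | deliver v => exact .inr ⟨v, rfl, rfl⟩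
  | process =>
    rcases process_cases f (E.state f R t) with ⟨-, h'⟩ | ⟨A, rest, -, h'⟩ <;>
      dsimp only <;> rw [h'] <;> exact .inl rfl
  | _ => exact .inl rfl

theorem view_mono : Monotone fun t => (E.state f R t).view := by
  refine monotone_nat_of_le_succ fun t => ?_
  rcases view_succ (E := E) (f := f) (R := R) t with h | ⟨v, -, h⟩ <;> simp only [h]
  · exact le_rfl
  · exact Set.subset_insert _ _

theorem finite_view (t : ℕ) : (E.state f R t).view.Finite := by
  induction t with
  | zero => exact Set.finite_empty
  | succ t ih =>
    rcases view_succ (E := E) (f := f) (R := R) t with h | ⟨v, -, h⟩ <;> rw [h]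
    · exact ih
    · exact ih.insert v

theorem exists_deliver {t : ℕ} {v : Vertex n D} (hv : v ∈ (E.state f R t).view) :
    ∃ t' < t, E.event R t' = .deliver v := by
  induction t with
  | zero => exact hv.elim
  | succ t ih =>
    rcases view_succ (E := E) (f := f) (R := R) t with h | ⟨w, hw, h⟩ <;> rw [h] at hv
    · obtain ⟨t', ht', h'⟩ := ih hv
      exact ⟨t', by omega, h'⟩
    · rcases hv with rfl | hv
      · exact ⟨t, by omega, hw⟩
      · obtain ⟨t', ht', h'⟩ := ih hv
        exact ⟨t', by omega, h'⟩

theorem round_pending_succ (t : ℕ) :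
    ((E.state f R (t + 1)).round = (E.state f R t).round ∧
      ((E.state f R (t + 1)).pending = (E.state f R t).pending ∨
        ∃ T, E.valid T ∧ E.ReceivesAt R T t ∧ (E.state f R (t + 1)).pending =
          (E.state f R t).pending ++ [(E.digest T, E.timer R t)])) ∨
    ((∃ strong weak, E.event R t = .propose strong weak) ∧
      (E.state f R (t + 1)).round = (E.state f R t).round + 1 ∧
      (E.state f R (t + 1)).pending = []) := by
  rw [state_succ, step]
  cases h : E.event R t with
  | receive T =>
    dsimp only
    split_ifs with hT
    · exact .inl ⟨rfl, .inr ⟨T, hT, h, rfl⟩⟩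
    · exact .inl ⟨rfl, .inl rfl⟩
  | propose strong weak => exact .inr ⟨⟨strong, weak, rfl⟩, rfl, rfl⟩
  | process =>
    rcases process_cases f (E.state f R t) with ⟨-, h'⟩ | ⟨A, rest, -, h'⟩ <;>
      dsimp only <;> rw [h'] <;> exact .inl ⟨rfl, .inl rfl⟩
  | _ => exact .inl ⟨rfl, .inl rfl⟩

theorem round_mono : Monotone fun t => (E.state f R t).round := by
  refine monotone_nat_of_le_succ fun t => ?_
  rcases round_pending_succ (E := E) (f := f) (R := R) t with ⟨h, -⟩ | ⟨-, h, -⟩ <;>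
    simp only [h] <;> omega

/-- Advancing the round empties the list, so a pending entry was received in the current round. The
clause on rounds later turns a bound on the round of a vertex into a bound on the time of receipt.
-/
theorem mem_pending {t : ℕ} {d : D} {oi : ℕ} (h : (d, oi) ∈ (E.state f R t).pending) :
    ∃ s T, E.valid T ∧ E.ReceivesAt R T s ∧ E.digest T = d ∧ oi = E.timer R s ∧
      (E.state f R s).round = (E.state f R t).round := by
  induction t with
  | zero => simp [state, init] at h
  | succ t ih =>
    rcases round_pending_succ (E := E) (f := f) (R := R) t with
      ⟨hr, hp | ⟨T, hT, hrec, hp⟩⟩ | ⟨-, -, hp⟩ <;> rw [hp] at h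
    · rw [hr]
      exact ih h
    · rw [hr]
      rcases List.mem_append.1 h with h | h
      · exact ih h
      · simp only [List.mem_singleton, Prod.mk.injEq] at h
        exact ⟨t, T, hT, hrec, h.1.symm, h.2, rfl⟩
    · simp at h

/-- An entry of the pending list stays there until it is broadcast. -/
theorem pending_or_broadcast {t : ℕ} {p : D × ℕ} (h : p ∈ (E.state f R t).pending) (t' : ℕ)
    (ht : t ≤ t') : p ∈ (E.state f R t').pending ∨
      ∃ u ≥ t, ∃ v, E.BroadcastsAt f R v u ∧ p ∈ v.payload := by
  induction t', ht using Nat.le_induction with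
  | base => exact .inl h
  | succ t' ht ih =>
    rcases ih with ih | ih
    · rcases round_pending_succ (E := E) (f := f) (R := R) t' with
        ⟨-, hp | ⟨T, -, -, hp⟩⟩ | ⟨⟨strong, weak, hev⟩, -, -⟩
      · exact .inl (hp ▸ ih)
      · exact .inl (hp ▸ List.mem_append_left _ ih)
      · exact .inr ⟨t', ht, _, ⟨strong, weak, hev, rfl⟩, ih⟩
    · exact .inr ih

theorem BroadcastsAt.author_eq {v : Vertex n D} {t : ℕ} (h : E.BroadcastsAt f R v t) :
    v.author = R := by
  obtain ⟨_, _, -, rfl⟩ := h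
  rfl

theorem BroadcastsAt.round_eq {v : Vertex n D} {t : ℕ} (h : E.BroadcastsAt f R v t) :
    v.round = (E.state f R t).round := by
  obtain ⟨_, _, -, rfl⟩ := h
  rfl

theorem BroadcastsAt.state_succ_eq {v : Vertex n D} {t : ℕ} (h : E.BroadcastsAt f R v t) :
    (E.state f R (t + 1)).round = v.round + 1 ∧ (E.state f R (t + 1)).pending = [] := by
  obtain ⟨_, _, h, rfl⟩ := h
  rw [state_succ, step, h]
  exact ⟨rfl, rfl⟩

theorem BroadcastsAt.mem_payload {v : Vertex n D} {t : ℕ} (h : E.BroadcastsAt f R v t) {d : D}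
    {oi : ℕ} (hp : (d, oi) ∈ v.payload) :
    ∃ s T, E.valid T ∧ E.ReceivesAt R T s ∧ E.digest T = d ∧ oi = E.timer R s ∧
      (E.state f R s).round = v.round := by
  obtain ⟨_, _, -, rfl⟩ := h
  exact mem_pending hp

/-- A valid transaction received by a correct replica is broadcast by it. -/
theorem DAGLayer.exists_broadcast_of_receive (hdag : E.DAGLayer f) (hR : R ∈ E.correct) {T : Tx}
    (hT : E.valid T) {t : ℕ} (h : E.ReceivesAt R T t) :
    ∃ u ≥ t, ∃ v, E.BroadcastsAt f R v u ∧ (E.digest T, E.timer R t) ∈ v.payload := by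
  have hmem : (E.digest T, E.timer R t) ∈ (E.state f R (t + 1)).pending := by
    rw [state_succ, step, h]
    simp [hT]
  obtain ⟨u, v, hb, hr⟩ := hdag.proposes R hR (E.state f R (t + 1)).round
  -- The proposal of the round that is current after the receipt cannot precede the receipt, since
  -- it would already have advanced the round.
  have hu : t + 1 ≤ u + 1 := by
    by_contra! hlt
    have := round_mono (E := E) (f := f) (R := R) (show u + 1 ≤ t + 1 by omega)
    simp only [hb.state_succ_eq.1] at this
    omega
  rcases pending_or_broadcast hmem (u + 1) hu with h' | ⟨u', hu', h'⟩
  · rw [hb.state_succ_eq.2] at h'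
    simp at h'
  · exact ⟨u', by omega, h'⟩

/-! ### Commits and the queue of the fairness layer -/

theorem queue_succ (t : ℕ) :
    (∃ l, (E.state f R (t + 1)).queue = (E.state f R t).queue ++ l) ∨
      (∃ A rest, E.event R t = .process ∧ (E.state f R t).queue = A :: rest ∧
        E.state f R (t + 1) = { processSubdag f (E.state f R t) A with queue := rest }) := by
  rw [state_succ, step]
  cases h : E.event R t with
  | receive T => dsimp only; split_ifs <;> exact .inl ⟨[], (List.append_nil _).symm⟩
  | commit L => exact .inl ⟨_, rfl⟩
  | process =>
    rcases process_cases f (E.state f R t) with ⟨-, h'⟩ | ⟨A, rest, hq, h'⟩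
    · exact .inl ⟨[], by simp only [h', List.append_nil]⟩
    · exact .inr ⟨A, rest, rfl, hq, h'⟩
  | _ => exact .inl ⟨[], (List.append_nil _).symm⟩

/-- At time `t`, the fairness layer of `R` processes the subdag `A`. -/
def ProcessesAt (E : Execution n Tx D) (f : ℕ) (R : Fin n) (A : List (Vertex n D)) (t : ℕ) : Prop :=
  ∃ rest, (E.state f R t).queue = A :: rest ∧
    E.state f R (t + 1) = { processSubdag f (E.state f R t) A with queue := rest }

/-- Until the next `process` event the queue only grows at its end. Induction on the delay of the
event given by fairness; an earlier one does as well. The remaining queue is recorded for the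
induction over the subdags in front of a given one. -/
theorem FollowsProtocol.exists_processesAt_head (hrun : E.FollowsProtocol f) (hR : R ∈ E.correct)
    {t : ℕ} {A : List (Vertex n D)} {rest : List (List (Vertex n D))}
    (h : (E.state f R t).queue = A :: rest) :
    ∃ t' ≥ t, E.ProcessesAt f R A t' ∧ ∃ l, (E.state f R (t' + 1)).queue = rest ++ l := by
  obtain ⟨u, hu, hev⟩ := hrun.process_fair R hR t (by simp [h])
  obtain ⟨k, rfl⟩ := Nat.exists_eq_add_of_le hu
  induction k generalizing t rest with
  | zero =>
    refine ⟨t, le_rfl, ?_⟩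
    rw [Nat.add_zero] at hev
    have hst : E.state f R (t + 1) = (E.state f R t).process f := by rw [state_succ, step, hev]
    rcases process_cases f (E.state f R t) with ⟨h', -⟩ | ⟨A', rest', hq, h'⟩
    · simp [h] at h'
    · obtain ⟨rfl, rfl⟩ := List.cons.inj (h.symm.trans hq)
      exact ⟨⟨_, h, hst.trans h'⟩, [], by rw [hst, h', List.append_nil]⟩
  | succ k ih =>
    rcases queue_succ (E := E) (f := f) (R := R) t with ⟨l, hl⟩ | ⟨A', rest', -, hq, h'⟩
    · rw [h, List.cons_append] at hl
      obtain ⟨t', ht', hp, l', hl'⟩ := ih hl (by omega) (by rwa [Nat.add_right_comm, Nat.add_assoc])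
      exact ⟨t', by omega, hp, l ++ l', by rw [hl', List.append_assoc]⟩
    · obtain ⟨rfl, rfl⟩ := List.cons.inj (h.symm.trans hq)
      exact ⟨t, le_rfl, ⟨_, h, h'⟩, [], by rw [h', List.append_nil]⟩

theorem FollowsProtocol.exists_processesAt (hrun : E.FollowsProtocol f) (hR : R ∈ E.correct)
    {t : ℕ} {A : List (Vertex n D)} (h : A ∈ (E.state f R t).queue) :
    ∃ t' ≥ t, E.ProcessesAt f R A t' := by
  obtain ⟨l₁, l₂, h⟩ := List.append_of_mem h
  induction l₁ generalizing t l₂ with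
  | nil =>
    obtain ⟨t', ht', hp, -⟩ := hrun.exists_processesAt_head hR h
    exact ⟨t', ht', hp⟩
  | cons B l₁ ih =>
    obtain ⟨t', ht', -, l, hl⟩ := hrun.exists_processesAt_head hR (rest := l₁ ++ A :: l₂) h
    obtain ⟨u, hu, hp⟩ := ih (t := t' + 1) (by simp [hl]) (l₂ ++ l) (by simpa using hl)
    exact ⟨u, by omega, hp⟩

/-- A vertex broadcast by a correct replica is processed by every correct replica, which has it in
its view by then. -/
theorem exists_processesAt_of_broadcast (hrun : E.FollowsProtocol f) (hdag : E.DAGLayer f)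
    (hR : R ∈ E.correct) {i : Fin n} (hi : i ∈ E.correct) {u : ℕ} {v : Vertex n D}
    (hv : E.BroadcastsAt f i v u) :
    ∃ t A, v ∈ (E.state f R t).view ∧ v ∈ A ∧ E.ProcessesAt f R A t := by
  obtain ⟨t, L, A, ⟨hc, rfl⟩, hmem⟩ := hdag.validity i hi u v hv R hR
  have hsub : (E.state f R t).subdag L ⊆ (E.state f R t).view :=
    Set.sdiff_subset.trans (causalHistory_subset (hrun.commit_ok R hR t L hc).1)
  have hq : E.enum.toList ((E.state f R t).subdag L) ∈ (E.state f R (t + 1)).queue := by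
    rw [state_succ, step, hc]
    exact List.mem_append_right _ List.mem_cons_self
  obtain ⟨t', ht', hp⟩ := hrun.exists_processesAt hR hq
  -- The enumeration is only specified on finite sets, hence the appeal to `finite_view`.
  exact ⟨t', _, view_mono (by omega : t ≤ t') (hsub hmem),
    (E.enum.mem_toList _ ((finite_view t).subset hsub) v).2 hmem, hp⟩

/-- The fairness layer of a correct replica never stops. -/
theorem exists_processesAt_ge (hrun : E.FollowsProtocol f) (hdag : E.DAGLayer f)
    (hR : R ∈ E.correct) (t : ℕ) : ∃ t' ≥ t, ∃ A, E.ProcessesAt f R A t' := by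
  -- The finite view at time `t` has bounded rounds, so a vertex of round `r + 1` is not in it and
  -- can only be processed later.
  obtain ⟨r, hr⟩ := ((finite_view (E := E) (f := f) (R := R) t).image Vertex.round).bddAbove
  obtain ⟨u, v, hb, hvr⟩ := hdag.proposes R hR (r + 1)
  obtain ⟨t', A, hv, -, hp⟩ := exists_processesAt_of_broadcast hrun hdag hR hR hb
  refine ⟨t', ?_, A, hp⟩
  by_contra! hlt
  have := hr (Set.mem_image_of_mem Vertex.round (view_mono hlt.le hv))
  omega

/-! ### The tables of the fairness layer -/

/-- Only processing a subdag changes the tables that the fairness layer owns. -/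
theorem tables_succ (t : ℕ) : (∃ A, E.ProcessesAt f R A t) ∨
    ((E.state f R (t + 1)).committedOis = (E.state f R t).committedOis ∧
      (E.state f R (t + 1)).digests = (E.state f R t).digests ∧
      (E.state f R (t + 1)).aoi = (E.state f R t).aoi ∧
      (E.state f R (t + 1)).lpaoi = (E.state f R t).lpaoi ∧
      (E.state f R (t + 1)).txnsWithAoi = (E.state f R t).txnsWithAoi ∧
      (E.state f R (t + 1)).final = (E.state f R t).final) := by
  unfold ProcessesAt
  rw [state_succ, step]
  cases h : E.event R t with
  | receive T => dsimp only; split_ifs <;> exact .inr ⟨rfl, rfl, rfl, rfl, rfl, rfl⟩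
  | process =>
    rcases process_cases f (E.state f R t) with ⟨-, h'⟩ | ⟨A, rest, hq, h'⟩
    · exact .inr (by simp only [h', and_self])
    · exact .inl ⟨A, rest, hq, h'⟩
  | _ => exact .inr ⟨rfl, rfl, rfl, rfl, rfl, rfl⟩

theorem committedOis_ne_top_mono {t t' : ℕ} (h : t ≤ t') {d : D} {i : Fin n}
    (hd : d ∈ (E.state f R t).digests ∧ (E.state f R t).committedOis d i ≠ ⊤) :
    d ∈ (E.state f R t').digests ∧ (E.state f R t').committedOis d i ≠ ⊤ := by
  induction t', h using Nat.le_induction with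
  | base => exact hd
  | succ t' _ ih =>
    rcases tables_succ (E := E) (f := f) (R := R) t' with ⟨A, rest, -, h⟩ | ⟨h, h', -⟩
    · rw [h]
      exact ⟨Finset.mem_union_left _ ih.1, foldl_record_ne_top A ih.2⟩
    · rwa [h, h']

theorem aoi_eq_mono {t t' : ℕ} (h : t ≤ t') {d : D} {a : ℕ} (hd : (E.state f R t).aoi d = a) :
    (E.state f R t').aoi d = a := by
  induction t', h using Nat.le_induction with
  | base => exact hd
  | succ t' _ ih =>
    rcases tables_succ (E := E) (f := f) (R := R) t' with ⟨A, rest, -, h⟩ | ⟨-, -, h, -⟩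
    · rw [h]
      exact (processSubdag_aoi_of_ne_top A (ih ▸ ENat.natCast_ne_top a)).trans ih
    · rwa [h]

theorem mem_final_mono {t t' : ℕ} (h : t ≤ t') {d : D} (hd : d ∈ (E.state f R t).final) :
    d ∈ (E.state f R t').final := by
  induction t', h using Nat.le_induction with
  | base => exact hd
  | succ t' _ ih =>
    rcases tables_succ (E := E) (f := f) (R := R) t' with ⟨A, rest, -, h⟩ | ⟨-, -, -, -, -, h⟩
    · rw [h]
      exact List.mem_append_left _ ih
    · rwa [h]

theorem assignedTracked_state (t : ℕ) : (E.state f R t).AssignedTracked := by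
  induction t with
  | zero => exact fun d hd => absurd rfl hd
  | succ t ih =>
    rcases tables_succ (E := E) (f := f) (R := R) t with ⟨A, rest, -, h⟩ | ⟨-, -, h, -, h', h''⟩
    · rw [h]
      exact ih.processSubdag A
    · rwa [AssignedTracked, h, h', h'']

/-- Every valid transaction received by a correct replica gets an AOI at every correct replica. -/
theorem exists_aoi (hn : 3 * f < n) (hbyz : E.correctᶜ.card ≤ f) (hrun : E.FollowsProtocol f)
    (hdag : E.DAGLayer f) (hshare : E.CorrectReplicasShareReceipts) {T : Tx} (hT : E.valid T)
    {j : Fin n} (hj : j ∈ E.correct) {s : ℕ} (hs : E.ReceivesAt j T s) (hR : R ∈ E.correct) :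
    ∃ a : ℕ, ∀ᶠ t in Filter.atTop, (E.state f R t).aoi (E.digest T) = a := by
  have hcom : ∀ i ∈ E.correct, ∀ᶠ t in Filter.atTop, E.digest T ∈ (E.state f R t).digests ∧
      (E.state f R t).committedOis (E.digest T) i ≠ ⊤ := by
    intro i hi
    obtain ⟨s', hs'⟩ := hshare T j hj s hs i hi
    obtain ⟨u, -, v, hb, hp⟩ := hdag.exists_broadcast_of_receive hi hT hs'
    obtain ⟨t, A, -, hvA, rest, -, hst⟩ := exists_processesAt_of_broadcast hrun hdag hR hi hb
    refine Filter.eventually_atTop.2 ⟨t + 1, fun t' ht' => committedOis_ne_top_mono ht' ?_⟩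
    rw [hst]
    constructor
    · refine Finset.mem_union_right _ (List.mem_toFinset.2 (List.mem_flatMap.2 ⟨v, hvA, ?_⟩))
      exact List.mem_map.2 ⟨_, hp, rfl⟩
    · have := foldl_record_ne_top_of_mem (E.state f R t).committedOis hvA hp
      rwa [hb.author_eq] at this
  obtain ⟨t₁, ht₁⟩ := Filter.eventually_atTop.1 ((Filter.eventually_all_finset _).2 hcom)
  obtain ⟨t₂, ht₂, A, rest, -, hst⟩ := exists_processesAt_ge hrun hdag hR t₁
  -- All correct indicators are finite before the processing at `t₂`, so it assigns the AOI unless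
  -- that has happened already.
  have hne : (E.state f R (t₂ + 1)).aoi (E.digest T) ≠ ⊤ := by
    rw [hst]
    refine processSubdag_aoi_ne_top (by omega) A (ht₁ t₂ ht₂ R hR).1 ?_
    have hcard := Finset.card_add_card_compl E.correct
    rw [Fintype.card_fin] at hcard
    refine le_trans (by omega) (Finset.card_le_card (s := E.correct) fun i hi => ?_)
    exact Finset.mem_filter.2 ⟨Finset.mem_univ _, (ht₁ t₂ ht₂ i hi).2⟩
  obtain ⟨a, ha⟩ := ENat.ne_top_iff_exists.1 hne
  exact ⟨a, Filter.eventually_atTop.2 ⟨t₂ + 1, fun t ht => aoi_eq_mono ht ha.symm⟩⟩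

/-! ### Lower bounds for the indicators of correct replicas -/

theorem seen_highest_succ (t : ℕ) :
    (∃ v, E.event R t = .deliver v ∧ E.state f R (t + 1) = (E.state f R t).deliver v) ∨
      ((E.state f R (t + 1)).view = (E.state f R t).view ∧
        (E.state f R (t + 1)).seenOis = (E.state f R t).seenOis ∧
        (E.state f R (t + 1)).highest = (E.state f R t).highest) := by
  rw [state_succ, step]
  cases h : E.event R t with
  | receive T => dsimp only; split_ifs <;> exact .inr ⟨rfl, rfl, rfl⟩
  | deliver v => exact .inl ⟨v, rfl, rfl⟩
  | process =>
    rcases process_cases f (E.state f R t) with ⟨-, h'⟩ | ⟨A, rest, -, h'⟩ <;>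
      dsimp only <;> rw [h'] <;> exact .inr ⟨rfl, rfl, rfl⟩
  | _ => exact .inr ⟨rfl, rfl, rfl⟩

theorem seenOis_eq_top_or (t : ℕ) (d : D) (i : Fin n) : (E.state f R t).seenOis d i = ⊤ ∨
    ∃ v ∈ (E.state f R t).view, v.author = i ∧
      ∃ oi : ℕ, (d, oi) ∈ v.payload ∧ (E.state f R t).seenOis d i = oi := by
  induction t with
  | zero => exact .inl rfl
  | succ t ih =>
    rcases seen_highest_succ (E := E) (f := f) (R := R) t with ⟨v, -, h⟩ | ⟨h, h', -⟩
    · rw [h]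
      simp only [ReplicaState.deliver]
      rcases record_eq_or (E.state f R t).seenOis v d i with ⟨hr, -⟩ | ⟨hi, oi, hoi, hr⟩ <;>
        simp only [hr]
      · refine ih.imp id ?_
        rintro ⟨w, hw, h⟩
        exact ⟨w, Set.mem_insert_of_mem _ hw, h⟩
      · exact .inr ⟨v, Set.mem_insert _ _, hi.symm, oi, hoi, rfl⟩
    · rwa [h, h']

/-- By authenticity the correct author did broadcast the vertex, so each of its indicators is a
timer reading at an actual receipt. -/
theorem DAGLayer.mem_payload_of_mem_view (hdag : E.DAGLayer f) (hR : R ∈ E.correct) {t : ℕ}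
    {v : Vertex n D} (hv : v ∈ (E.state f R t).view) (hi : v.author ∈ E.correct) {d : D} {oi : ℕ}
    (hp : (d, oi) ∈ v.payload) :
    ∃ s T, E.valid T ∧ E.ReceivesAt v.author T s ∧ E.digest T = d ∧ oi = E.timer v.author s ∧
      (E.state f v.author s).round = v.round := by
  obtain ⟨t', -, hd⟩ := exists_deliver hv
  obtain ⟨u, -, hb⟩ := hdag.authentic R hR t' v hd hi
  exact hb.mem_payload hp

/-- Descend along the strong edges to the author's own previous vertex, whose targets are in the
view before their source. This needs no correctness of the author. -/
theorem FollowsProtocol.exists_mem_view_of_le (hrun : E.FollowsProtocol f) (hR : R ∈ E.correct)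
    {t : ℕ} {v : Vertex n D} (hv : v ∈ (E.state f R t).view) {r : ℕ} (hr : r ≤ v.round) :
    ∃ w ∈ (E.state f R t).view, w.id = (v.author, r) := by
  obtain ⟨k, hk⟩ := Nat.exists_eq_add_of_le hr
  induction k generalizing v with
  | zero => exact ⟨v, hv, by rw [Vertex.id, hk, Nat.add_zero]⟩
  | succ k ih =>
    obtain ⟨t', ht', hd⟩ := exists_deliver hv
    obtain ⟨hwf, hrefs, -⟩ := hrun.deliver_ok R hR t' v hd
    obtain ⟨w, hw, hid⟩ := hrefs _ (Finset.mem_union_left _ (hwf.2 (by omega)).2.2.1)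
    simp only [Vertex.id, Prod.mk.injEq] at hid
    have := ih (view_mono ht'.le hw) (by omega) (by omega)
    rwa [hid.1] at this

/-- The vertices of an author are delivered in the order of their rounds. -/
theorem FollowsProtocol.round_lt_of_deliver (hrun : E.FollowsProtocol f) (hR : R ∈ E.correct)
    {t : ℕ} {v w : Vertex n D} (hv : v ∈ (E.state f R t).view) (hw : E.event R t = .deliver w)
    (h : w.author = v.author) : v.round < w.round := by
  by_contra! hle
  -- Otherwise the view would already contain a vertex with the author and round of `w`.
  obtain ⟨u, hu, hid⟩ := hrun.exists_mem_view_of_le hR hv hle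
  exact (hrun.deliver_ok R hR t w hw).2.2 u hu (by rw [hid, ← h, Vertex.id])

/-- The highest indicator of a correct replica exceeds every bound eventually. -/
theorem eventually_lt_highest (hrun : E.FollowsProtocol f) (hdag : E.DAGLayer f)
    (htraffic : E.OngoingTraffic) (hR : R ∈ E.correct) {i : Fin n} (hi : i ∈ E.correct) (a : ℕ) :
    ∀ᶠ t in Filter.atTop, a < (E.state f R t).highest i := by
  obtain ⟨τ, hτ⟩ := hrun.timer_unbounded i hi a
  -- Vertices of later rounds than the round of `i` at time `τ` hold only indicators above `a`.
  have hlate : ∀ t v, v ∈ (E.state f R t).view → v.author = i →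
      (E.state f i τ).round < v.round → ∀ d oi, (d, oi) ∈ v.payload → a < oi := by
    rintro t v hv rfl hr d oi hp
    obtain ⟨s, T, -, -, -, rfl, hs⟩ := hdag.mem_payload_of_mem_view hR hv hi hp
    refine hτ.trans_le (hrun.timer_mono _ hi ?_)
    by_contra! hlt
    have := round_mono (E := E) (f := f) (R := v.author) hlt.le
    simp only at this
    omega
  obtain ⟨u₀, v₀, hb₀, hr₀⟩ := hdag.proposes i hi (E.state f i τ).round
  obtain ⟨s, hs, T, hT, hrec⟩ := htraffic i hi (u₀ + 1)
  obtain ⟨u, hu, v, hb, hp⟩ := hdag.exists_broadcast_of_receive hi hT hrec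
  have hvr : (E.state f i τ).round < v.round := by
    have := round_mono (E := E) (f := f) (R := i) (show u₀ + 1 ≤ u by omega)
    simp only [hb₀.state_succ_eq.1, ← hb.round_eq] at this
    omega
  obtain ⟨t₀, A, hv, -, -⟩ := exists_processesAt_of_broadcast hrun hdag hR hi hb
  -- Delivery of `v` lifts `highest` above `a`. Later vertices of `i` have higher rounds, so each
  -- has only indicators above `a` or, with an empty payload, leaves `highest` unchanged.
  have key : ∀ t, v ∈ (E.state f R t).view → a < (E.state f R t).highest i := by
    intro t
    induction t with
    | zero => exact fun h => h.elim
    | succ t ih =>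
      intro hvt
      rcases seen_highest_succ (E := E) (f := f) (R := R) t with ⟨w, hw, h⟩ | ⟨h, -, h'⟩
      · have hwview : w ∈ (E.state f R (t + 1)).view := by
          rw [h]
          exact Set.mem_insert _ _
        have hmax : w.author = i → (E.state f R (t + 1)).highest i =
            (w.payload.map Prod.snd).max?.getD ((E.state f R t).highest i) := by
          rintro rfl
          rw [h]
          simp [ReplicaState.deliver]
        have hother : w.author ≠ i →
            (E.state f R (t + 1)).highest i = (E.state f R t).highest i := by
          intro hne
          rw [h]
          simp [ReplicaState.deliver, Function.update_of_ne hne.symm]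
        by_cases hwi : w.author = i
        · by_cases hvold : v ∈ (E.state f R t).view
          · have hlt := hrun.round_lt_of_deliver hR hvold hw (hwi.trans hb.author_eq.symm)
            rw [hmax hwi]
            cases hm : (w.payload.map Prod.snd).max? with
            | none => exact ih hvold
            | some m =>
              obtain ⟨⟨d, oi⟩, hmem, rfl⟩ := List.mem_map.1 (List.max?_mem hm)
              exact hlate _ w hwview hwi (hvr.trans hlt) d oi hmem
          · obtain rfl : v = w := by
              rw [h] at hvt
              exact hvt.resolve_right hvold
            rw [hmax hwi]
            cases hm : (v.payload.map Prod.snd).max? with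
            | none =>
              rw [List.max?_eq_none_iff, List.map_eq_nil_iff] at hm
              simp [hm] at hp
            | some m =>
              obtain ⟨⟨d, oi⟩, hmem, rfl⟩ := List.mem_map.1 (List.max?_mem hm)
              exact hlate _ v hwview hwi hvr d oi hmem
        · rw [hother hwi]
          rw [h] at hvt
          exact ih (hvt.resolve_left fun hvw => hwi (hvw ▸ hb.author_eq))
      · rw [h']
        exact ih (h ▸ hvt)
  exact Filter.eventually_atTop.2 ⟨t₀, fun t ht => key t (view_mono ht hv)⟩

/-- Eventually, a digest without an AOI has only large indicators from correct replicas. -/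
theorem eventually_lt_seenOis (hn : 3 * f < n) (hbyz : E.correctᶜ.card ≤ f)
    (hrun : E.FollowsProtocol f) (hdag : E.DAGLayer f) (hshare : E.CorrectReplicasShareReceipts)
    (hR : R ∈ E.correct) {i : Fin n} (hi : i ∈ E.correct) (a : ℕ) :
    ∀ᶠ t in Filter.atTop, ∀ d, (E.state f R t).aoi d = ⊤ →
      (a : ℕ∞) < (E.state f R t).seenOis d i := by
  obtain ⟨τ, hτ⟩ := hrun.timer_unbounded i hi a
  -- Each of the finitely many times before `τ` has at most one receipt, so one threshold covers all
  -- these digests.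
  have hearly : ∀ s ∈ Finset.range τ, ∀ᶠ t in Filter.atTop, ∀ T, E.valid T →
      E.ReceivesAt i T s → (E.state f R t).aoi (E.digest T) ≠ ⊤ := by
    intro s _
    by_cases h : ∃ T, E.valid T ∧ E.ReceivesAt i T s
    · obtain ⟨T, hT, hrec⟩ := h
      obtain ⟨b, hb⟩ := exists_aoi hn hbyz hrun hdag hshare hT hi hrec hR
      filter_upwards [hb] with t ht T' _ hrec'
      obtain rfl : T = T' := Event.receive.inj (hrec.symm.trans hrec')
      exact ht ▸ ENat.natCast_ne_top b
    · exact Filter.Eventually.of_forall fun t T hT hrec => absurd ⟨T, hT, hrec⟩ h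
  filter_upwards [(Filter.eventually_all_finset _).2 hearly] with t ht d hd
  rcases seenOis_eq_top_or (E := E) (f := f) (R := R) t d i with h | ⟨v, hv, rfl, oi, hp, h⟩ <;>
    rw [h]
  · exact ENat.natCast_lt_top a
  · obtain ⟨s, T, hT, hrec, rfl, rfl, -⟩ := hdag.mem_payload_of_mem_view hR hv hi hp
    have hs : τ ≤ s := by
      by_contra! hlt
      exact ht s (Finset.mem_range.2 hlt) T hT hrec hd
    exact_mod_cast hτ.trans_le (hrun.timer_mono _ hi hs)

end Execution

end FairDAG

/-! ### Liveness -/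

theorem mainTheorem5 {Tx D : Type*} [LinearOrder D] {n f : ℕ} (hn : 3 * f < n)
    (E : FairDAG.Execution n Tx D)
    (hbyz : E.correctᶜ.card ≤ f)
    (hrun : E.FollowsProtocol f)
    (hdag : E.DAGLayer f)
    (hshare : E.CorrectReplicasShareReceipts)
    (htraffic : E.OngoingTraffic)
    (T : Tx) (hT : E.valid T)
    (hreceived : ∃ R ∈ E.correct, ∃ t, E.ReceivesAt R T t) :
    ∀ R ∈ E.correct, ∃ (a t₀ : ℕ), ∀ t ≥ t₀,
      (E.state f R t).aoi (E.digest T) = a ∧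
      (∀ d, (E.state f R t).aoi d = ⊤ → (a : ℕ∞) < (E.state f R t).lpaoi d) ∧
      E.digest T ∈ (E.state f R t).final := by
  intro R hR
  obtain ⟨j, hj, s, hs⟩ := hreceived
  obtain ⟨a, ha⟩ := FairDAG.Execution.exists_aoi hn hbyz hrun hdag hshare hT hj hs hR
  have hbig : ∀ i ∈ E.correct, ∀ᶠ t in Filter.atTop, ∀ d, (E.state f R t).aoi d = ⊤ →
      (a : ℕ∞) < min ((E.state f R t).seenOis d i) ((E.state f R t).highest i : ℕ∞) := by
    intro i hi
    filter_upwards [FairDAG.Execution.eventually_lt_seenOis hn hbyz hrun hdag hshare hR hi a,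
      FairDAG.Execution.eventually_lt_highest hrun hdag htraffic hR hi a] with t h h' d hd
    exact lt_min (h d hd) (by exact_mod_cast h')
  obtain ⟨t₁, ht₁⟩ := Filter.eventually_atTop.1
    (ha.and ((Filter.eventually_all_finset _).2 hbig))
  have hlp : ∀ t ≥ t₁, ∀ A, E.ProcessesAt f R A t → ∀ d,
      (FairDAG.ReplicaState.processSubdag f (E.state f R t) A).aoi d = ⊤ →
      (a : ℕ∞) < (FairDAG.ReplicaState.processSubdag f (E.state f R t) A).lpaoi d := by
    intro t ht A _ d hd
    rw [FairDAG.ReplicaState.processSubdag_lpaoi A hd]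
    -- An AOI is never withdrawn, so `d` had none before the processing either, and the bounds for
    -- the state at `t` apply.
    have hd' : (E.state f R t).aoi d = ⊤ := by
      by_contra hne
      exact hne ((FairDAG.ReplicaState.processSubdag_aoi_of_ne_top A hne).symm.trans hd)
    refine FairDAG.lt_nthSmallest (by omega) _ _ (le_trans (Finset.card_le_card ?_) hbyz)
    intro i hi
    rw [Finset.mem_compl]
    intro hc
    exact ((ht₁ t ht).2 i hc d hd').not_ge (Finset.mem_filter.1 hi).2
  -- Stored LPAOI values may be outdated at `t₁`; the first processing from then on refreshes them.
  obtain ⟨t₂, ht₂, A, hA⟩ := FairDAG.Execution.exists_processesAt_ge hrun hdag hR t₁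
  have hA' := hA
  obtain ⟨rest, -, hst⟩ := hA'
  refine ⟨a, t₂ + 1, fun t ht => ⟨(ht₁ t (by omega)).1, ?_, ?_⟩⟩
  · induction t, ht using Nat.le_induction with
    | base =>
      rw [hst]
      exact hlp t₂ ht₂ A hA
    | succ t ht ih =>
      rcases FairDAG.Execution.tables_succ (E := E) (f := f) (R := R) t with
        ⟨B, hB⟩ | ⟨-, -, h, h', -⟩
      · have hB' := hB
        obtain ⟨_, -, hst'⟩ := hB'
        rw [hst']
        exact hlp t (by omega) B hB
      · rw [h, h']
        exact ih
  · refine FairDAG.Execution.mem_final_mono ht ?_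
    rw [hst]
    exact FairDAG.ReplicaState.mem_final_processSubdag
      (FairDAG.Execution.assignedTracked_state t₂) A (ht₁ t₂ ht₂).1 (hlp t₂ ht₂ A hA)
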